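/- **Notation.** Let $f:X\to Y$ be a morphism of schemes, with $X$ Noetherian, and let $Z\subseteq Y$ be a closed subscheme. For an affine open $U=\operatorname{Spec}A\subseteq X$ with $U\cap f^{-1}(Z)\neq\emptyset$, let $I\subseteq A$ be the ideal defining $Z\times_Y U$ in $U$, let $\mathfrak p_1,\dots,\mathfrak p_r$ be the minimal primes of $I$, and put $$m_{f,Z,U}=\min_{1\le i\le r}\max\{e\in\mathbb Z_{\ge 0}: I\subseteq\mathfrak p_i^{\,e}\}\in\mathbb Z_{\ge1}\cup\{\infty\}$$ (the maximum of an unbounded set being $\infty$). Let $m_{f,Z}$ be the minimum of $m_{f,Z,U}$ over all affine open $U\subseteq X$ meeting $f^{-1}(Z)$. For a local ring $A$ that is a discrete valuation ring or a field, with maximal ideal $\mathfrak m_A$, an $A$-scheme $\mathcal Y$, a closed subscheme $\mathcal Z\subseteq\mathcal Y$ and $m\in\mathbb Z_{\ge1}\cup\{\infty\}$, let $(\mathcal Y,\mathcal Z,m)(A)$ be the set of all $y\in\mathcal Y(A)$ such that either $y\in\mathcal Z(A)$, or $n_{y,\mathcal Z}=0$, or $n_{y,\mathcal Z}\ge m$,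 where for $y\notin\mathcal Z(A)$ the integer $n_{y,\mathcal Z}\ge 0$ is defined by $\operatorname{Spec}A\times_{\mathcal Y}\mathcal Z=\operatorname{Spec}(A/\mathfrak m_A^{\,n_{y,\mathcal Z}})$ as closed subschemes of $\operatorname{Spec}A$ (the fibre product being taken along $y$). For a domain $R$ with fraction field $k$, an $R$-model of a $k$-scheme $V$ is an $R$-scheme $\mathcal V$ together with an isomorphism $\mathcal V\times_R k\cong V$ over $k$. **Theorem.** Let $R$ be a Dedekind domain with fraction field $k$. Let $f:X\to Y$ be a dominant $k$-morphism of integral proper $k$-varieties with reduced generic fibre. Let $\mathcal Y$ be a proper $R$-model of $Y$. Let $Z\subseteq Y$ be an integral closed subscheme, and let $\mathcal Z\subseteq\mathcal Y$ be an integral closed subscheme that is an $R$-model of $Z$, compatibly with the identification $\mathcal Y\times_Rk\cong Y$. For a maximal ideal $\mathfrak m$ of $R$, let $\mathcal Y_{\mathfrak m}$ and $\mathcal Z_{\mathfrak m}$ be the base changes of $\mathcal Y$ and $\mathcal Z$ to $R_{\mathfrak m}$, and regard $\mathcal Y_{\mathfrak m}(R_{\mathfrak m})$ as a subset of $Y(k)$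 by restriction to the generic fibre. Then $$f(X(k))\subseteq(\mathcal Y_{\mathfrak m},\mathcal Z_{\mathfrak m},m_{f,Z})(R_{\mathfrak m})$$ for all but finitely many maximal ideals $\mathfrak m$ of $R$. -/

import Mathlib

open CategoryTheory CategoryTheory.Limits AlgebraicGeometry

universe u

noncomputable section

/-- The `S`-points of an `S`-scheme `π : X ⟶ S`, i.e. the sections of `π`. For `S = Spec k` this
is the set `X(k)`. -/
def sectionPoints {X S : Scheme.{u}} (π : X ⟶ S) : Set (S ⟶ X) :=
  {x | x ≫ π = 𝟙 S}

/-- Let `j : Z ⟶ Y` be a closed subscheme, `f : X ⟶ Y` a morphism and `U = Spec A` an affine open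
subset of `X`. This is the ideal of `A` that defines `Z ×_Y U` as a closed subscheme of `U`. -/
def pullbackIdeal {X Y Z : Scheme.{u}} (f : X ⟶ Y) (j : Z ⟶ Y) (U : X.affineOpens) :
    Ideal Γ(X, U) :=
  (pullback.fst f j).ker.ideal U

/-- `m_{f,Z,U}`: the minimum over the isolated primes `p` of the ideal `I` of `Z ×_Y U` of
`max {e : I ⊆ p ^ e}`, with the convention that the maximum of an unbounded set is `∞`. -/
def orbifoldMultiplicityOn {X Y Z : Scheme.{u}} (f : X ⟶ Y) (j : Z ⟶ Y) (U : X.affineOpens) :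
    ℕ∞ :=
  ⨅ p ∈ (pullbackIdeal f j U).minimalPrimes,
    ⨆ e ∈ {e : ℕ | pullbackIdeal f j U ≤ p ^ e}, (e : ℕ∞)

/-- `m_{f,Z}`: the smallest `m_{f,Z,U}`, where `U` runs over all the affine open subsets of `X`
that meet `f⁻¹(Z)`. -/
def orbifoldMultiplicity {X Y Z : Scheme.{u}} (f : X ⟶ Y) (j : Z ⟶ Y) : ℕ∞ :=
  ⨅ U ∈ {U : X.affineOpens | ∃ x : X, x ∈ U.1 ∧ f x ∈ Set.range j},
    orbifoldMultiplicityOn f j U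

/-- For a local ring `A`, a closed subscheme `i : 𝒵 ⟶ 𝒴` and a point `y : Spec A ⟶ 𝒴`, this says
that `y ×_𝒴 𝒵 = Spec (A / 𝔪_A ^ n)` as closed subschemes of `Spec A`. If `A` is a discrete
valuation ring with uniformizer `ϖ`, then `𝔪_A ^ n = (ϖ) ^ n`. -/
def HasIntersectionMultiplicity {A : Type u} [CommRing A] [IsLocalRing A] {𝒴 𝒵 : Scheme.{u}}
    (y : Spec (CommRingCat.of A) ⟶ 𝒴) (i : 𝒵 ⟶ 𝒴) (n : ℕ) : Prop :=
  Nonempty (Over.mk (pullback.fst y i) ≅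
    Over.mk (Spec.map (CommRingCat.ofHom
      (Ideal.Quotient.mk (IsLocalRing.maximalIdeal A ^ n)))))

/-- `(𝒴, 𝒵, m)(A)`: the `A`-points `y` of `𝒴` such that `y ∈ 𝒵(A)`, or `n_{y,𝒵} = 0`, or
`n_{y,𝒵} ≥ m`, where `n_{y,𝒵}` is the intersection multiplicity of `y` with `𝒵`. -/
def campanaPoints {A : Type u} [CommRing A] [IsLocalRing A] {𝒴 𝒵 : Scheme.{u}}
    (π : 𝒴 ⟶ Spec (CommRingCat.of A)) (i : 𝒵 ⟶ 𝒴) (m : ℕ∞) :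
    Set (Spec (CommRingCat.of A) ⟶ 𝒴) :=
  {y | y ∈ sectionPoints π ∧
    ((∃ z : Spec (CommRingCat.of A) ⟶ 𝒵, z ≫ i = y) ∨
      ∃ n : ℕ, HasIntersectionMultiplicity y i n ∧ (n = 0 ∨ m ≤ n))}

/-- The morphism `Spec B ⟶ Spec A` of an `A`-algebra `B`. -/
abbrev specAlgebraMap (A B : Type u) [CommRing A] [CommRing B] [Algebra A B] :
    Spec (CommRingCat.of B) ⟶ Spec (CommRingCat.of A) :=
  Spec.map (CommRingCat.ofHom (algebraMap A B))

/-- `π𝒴 : 𝒴 ⟶ Spec R` is an `R`-model of `πY : Y ⟶ Spec k` through `g : Y ⟶ 𝒴`, i.e. `g`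
identifies `Y` with the generic fibre `𝒴 ×_R k` over `k`. -/
def IsModel (R k : Type u) [CommRing R] [Field k] [Algebra R k] {𝒴 Y : Scheme.{u}}
    (π𝒴 : 𝒴 ⟶ Spec (CommRingCat.of R)) (πY : Y ⟶ Spec (CommRingCat.of k)) (g : Y ⟶ 𝒴) : Prop :=
  IsPullback g πY π𝒴 (specAlgebraMap R k)

/-- The inclusion `R_𝔪 → k` of a localization of a domain `R` into its fraction field `k`. -/
def localizationToFractionField (R k : Type u) [CommRing R] [IsDomain R] [Field k] [Algebra R k]
    [IsFractionRing R k] (𝔪 : MaximalSpectrum R) :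
    Localization.AtPrime 𝔪.asIdeal →+* k :=
  IsLocalization.lift (M := 𝔪.asIdeal.primeCompl) (g := algebraMap R k) fun s =>
    IsUnit.mk0 _ (IsFractionRing.to_map_ne_zero_of_mem_nonZeroDivisors
      (𝔪.asIdeal.primeCompl_le_nonZeroDivisors s.2))

/-- The base change `𝒴_𝔪 ⟶ Spec R_𝔪` of an `R`-scheme `𝒴`. -/
abbrev localModel {R : Type u} [CommRing R] {𝒴 : Scheme.{u}}
    (π : 𝒴 ⟶ Spec (CommRingCat.of R)) (𝔪 : MaximalSpectrum R) :
    pullback π (specAlgebraMap R (Localization.AtPrime 𝔪.asIdeal)) ⟶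
      Spec (CommRingCat.of (Localization.AtPrime 𝔪.asIdeal)) :=
  pullback.snd _ _

/-- The base change `𝒵_𝔪 ⟶ 𝒴_𝔪` of a morphism `i : 𝒵 ⟶ 𝒴` of `R`-schemes. -/
abbrev localInclusion {R : Type u} [CommRing R] {𝒴 𝒵 : Scheme.{u}}
    (π : 𝒴 ⟶ Spec (CommRingCat.of R)) (i : 𝒵 ⟶ 𝒴) (𝔪 : MaximalSpectrum R) :
    pullback (i ≫ π) (specAlgebraMap R (Localization.AtPrime 𝔪.asIdeal)) ⟶
      pullback π (specAlgebraMap R (Localization.AtPrime 𝔪.asIdeal)) :=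
  pullback.map _ _ _ _ i (𝟙 _) (𝟙 _) (by simp) (by simp)

/-- The point `y : Spec R_𝔪 ⟶ 𝒴_𝔪` restricts to the point `p : Spec k ⟶ Y` of the generic fibre
`Y` of `𝒴` (embedded by `g : Y ⟶ 𝒴`): the two morphisms `Spec k ⟶ 𝒴` they induce agree. -/
def RestrictsTo {R k : Type u} [CommRing R] [IsDomain R] [Field k] [Algebra R k]
    [IsFractionRing R k] {𝒴 Y : Scheme.{u}} (π𝒴 : 𝒴 ⟶ Spec (CommRingCat.of R)) (g : Y ⟶ 𝒴)
    (𝔪 : MaximalSpectrum R)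
    (y : Spec (CommRingCat.of (Localization.AtPrime 𝔪.asIdeal)) ⟶
      pullback π𝒴 (specAlgebraMap R (Localization.AtPrime 𝔪.asIdeal)))
    (p : Spec (CommRingCat.of k) ⟶ Y) : Prop :=
  Spec.map (CommRingCat.ofHom (localizationToFractionField R k 𝔪)) ≫ y ≫ pullback.fst _ _ =
    p ≫ g

end

/-! Suppose that infinitely many `𝔪` are bad, and choose for each of them a point `x_𝔪 ∈ X(k)` that
violates the conclusion. Fix a nonprincipal ultrafilter on the set of bad `𝔪`, and let `K` be the
ultrapower of `k` and `O ⊆ K` the ultraproduct of the rings `R_𝔪`. Then `O` is a valuation ring, and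
it contains `k` because a given element of `k` is integral at all but finitely many `𝔪`. The `x_𝔪`
assemble to a `K`-point of `X`. As `X` is proper over `k` and `O` is a `k`-algebra, this point
extends to an `O`-point, without any model of `X` (`exists_isUltraEval_of_isProper`).

Let `U` be an affine open neighbourhood of the image of the closed point, mapping into an affine
open `V ⊆ 𝒴`, and let `ψ : Γ(X, U) → O` be the resulting map. The ideal `I` of `Z ×_Y U` is extended
from the ideal `J` of `𝒵` on `V` (`pullbackIdeal_eq_map`). If `ψ(I)` contains a unit, the
multiplicity is `0` for almost all `𝔪`. Otherwise the prime `ψ⁻¹(𝔪_O)` contains a minimal prime `p`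
of `I`, so `I ⊆ p ^ n` gives `ψ(I) ⊆ 𝔪_O ^ n`. In the manner of Łoś's theorem, this says that almost
all multiplicities are at least `n`, or that the point lies on `𝒵`
(`eventually_map_eq_bot_or_eq_maximalIdeal_pow`). If `m_{f,Z} = ∞`, then `I = 0` by Krull's
intersection theorem, and almost all points lie on `𝒵`. Either way some chosen `x_𝔪` is not bad. -/

open Filter

/-! ### Ideal sheaves on affine schemes and pullbacks of closed subschemes -/

namespace AlgebraicGeometry.Scheme.IdealSheafData

/-- The ideal of `R` that corresponds to an ideal sheaf on `Spec R`. -/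
noncomputable def specIdeal {R : CommRingCat.{u}} (I : (Spec R).IdealSheafData) : Ideal R :=
  (I.ideal ⟨⊤, isAffineOpen_top _⟩).comap (Scheme.ΓSpecIso R).inv.hom

theorem specIdeal_injective {R : CommRingCat.{u}} :
    Function.Injective (specIdeal : (Spec R).IdealSheafData → Ideal R) := by
  intro I I' h
  refine ext_of_isAffine ?_
  exact Ideal.comap_injective_of_surjective _
    (ConcreteCategory.bijective_of_isIso (Scheme.ΓSpecIso R).inv).2 h

theorem specIdeal_ker {R S : CommRingCat.{u}} (φ : R ⟶ S) :
    specIdeal (Spec.map φ).ker = RingHom.ker φ.hom := by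
  ext x
  have h : (Spec.map φ).app ⊤ ((Scheme.ΓSpecIso R).inv x) = (Scheme.ΓSpecIso S).inv (φ x) := by
    have := congr($(Scheme.ΓSpecIso_inv_naturality φ) x)
    exact this.symm
  rw [specIdeal, Hom.ker_apply, Ideal.mem_comap, RingHom.mem_ker, RingHom.mem_ker]
  erw [h]
  exact map_eq_zero_iff _ (ConcreteCategory.bijective_of_isIso (Scheme.ΓSpecIso S).inv).1

theorem specIdeal_le_iff {R : CommRingCat.{u}} {I I' : (Spec R).IdealSheafData} :
    specIdeal I ≤ specIdeal I' ↔ I ≤ I' := by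
  refine ⟨fun h => le_of_isAffine ?_, fun h => Ideal.comap_mono (h _)⟩
  intro x hx
  obtain ⟨y, rfl⟩ := (ConcreteCategory.bijective_of_isIso (Scheme.ΓSpecIso R).inv).2 x
  exact h hx

theorem specIdeal_surjective {R : CommRingCat.{u}} :
    Function.Surjective (specIdeal : (Spec R).IdealSheafData → Ideal R) := fun I =>
  ⟨(Spec.map (CommRingCat.ofHom (Ideal.Quotient.mk I))).ker, by
    rw [specIdeal_ker]; exact Ideal.mk_ker⟩

/-- Every ideal sheaf on `Spec S` is the kernel of a quotient map, so both sides are kernels of the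
same composite. -/
theorem specIdeal_map {R S : CommRingCat.{u}} (φ : R ⟶ S) (I : (Spec S).IdealSheafData) :
    specIdeal (I.map (Spec.map φ)) = (specIdeal I).comap φ.hom := by
  obtain ⟨I, rfl⟩ : ∃ I' : Ideal S, I = (Spec.map (CommRingCat.ofHom (Ideal.Quotient.mk I'))).ker :=
    ⟨specIdeal I, specIdeal_injective (by rw [specIdeal_ker]; exact Ideal.mk_ker.symm)⟩
  rw [map_ker, ← Spec.map_comp, specIdeal_ker, specIdeal_ker]
  rfl

/-- Both sides are left adjoint to operations that `specIdeal_map` identifies. -/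
theorem specIdeal_comap {R S : CommRingCat.{u}} (φ : R ⟶ S) (I : (Spec R).IdealSheafData) :
    specIdeal (I.comap (Spec.map φ)) = (specIdeal I).map φ.hom := by
  refine eq_of_forall_ge_iff fun c => ?_
  obtain ⟨c, rfl⟩ := specIdeal_surjective c
  rw [specIdeal_le_iff, ← le_map_iff_comap_le, ← specIdeal_le_iff, specIdeal_map,
    Ideal.map_le_iff_le_comap]

theorem specIdeal_comap_fromSpec {X : Scheme.{u}} (I : X.IdealSheafData) {U : X.Opens}
    (hU : IsAffineOpen U) : specIdeal (I.comap hU.fromSpec) = I.ideal ⟨U, hU⟩ := by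
  have h : hU.fromSpec ''ᵁ ⊤ = U := by simp
  -- The image of `⊤` under `hU.fromSpec` equals `U` only propositionally, so the two rings of
  -- sections are compared by restriction along this equality.
  have key : (Scheme.ΓSpecIso Γ(X, U)).inv ≫ (hU.fromSpec.appIso ⊤).inv =
      X.presheaf.map (eqToHom h).op := by
    rw [Iso.comp_inv_eq, Scheme.Hom.appIso_hom', Scheme.Hom.map_appLE,
      Scheme.Hom.appLE, hU.fromSpec_app_self, Category.assoc, ← Functor.map_comp, ← op_comp]
    exact (Category.comp_id _).symm.trans (by congr 1)
  rw [specIdeal, ideal_comap_of_isOpenImmersion, Ideal.comap_comap, ← CommRingCat.hom_comp]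
  erw [key]
  have h' : (⟨hU.fromSpec ''ᵁ ⊤, (isAffineOpen_top _).image_of_isOpenImmersion _⟩ :
      X.affineOpens) = ⟨U, hU⟩ := Subtype.ext h
  refine le_antisymm ?_ (I.ideal_le_comap_ideal (V := ⟨U, hU⟩) h'.le)
  intro x hx
  have := I.ideal_le_comap_ideal (U := ⟨U, hU⟩) h'.ge (Ideal.mem_comap.1 hx)
  have e : X.presheaf.map (eqToHom h).op ≫ X.presheaf.map (homOfLE h.ge).op = 𝟙 _ :=
    (X.presheaf.map_comp _ _).symm.trans (X.presheaf.map_id _)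
  have ex : X.presheaf.map (homOfLE h.ge).op (X.presheaf.map (eqToHom h).op x) = x := congr($e x)
  rw [← ex]
  exact this

end AlgebraicGeometry.Scheme.IdealSheafData

open Scheme.IdealSheafData in
/-- The base change of a closed immersion `i` along a morphism `Spec A ⟶ V` into an affine open
subset `V` is defined by the extension of the ideal of `i` on `V`. -/
theorem exists_isPullback_quotient_map_ideal_ker {Y Z : Scheme.{u}} (i : Z ⟶ Y)
    [IsClosedImmersion i] {V : Y.Opens} (hV : IsAffineOpen V) {A : Type u} [CommRing A]
    (β : Γ(Y, V) →+* A) :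
    ∃ z, IsPullback (Spec.map (CommRingCat.ofHom
      (Ideal.Quotient.mk ((i.ker.ideal ⟨V, hV⟩).map β)))) z
      (Spec.map (CommRingCat.ofHom β) ≫ hV.fromSpec) i := by
  have hker : i.ker.comap (Spec.map (CommRingCat.ofHom β) ≫ hV.fromSpec) =
      (Spec.map (CommRingCat.ofHom (Ideal.Quotient.mk ((i.ker.ideal ⟨V, hV⟩).map β)))).ker := by
    refine specIdeal_injective ?_
    rw [comap_comp, specIdeal_comap, specIdeal_comap_fromSpec, specIdeal_ker]
    exact Ideal.mk_ker.symm
  let z := IsClosedImmersion.lift i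
    (Spec.map (CommRingCat.ofHom (Ideal.Quotient.mk ((i.ker.ideal ⟨V, hV⟩).map β))) ≫
      Spec.map (CommRingCat.ofHom β) ≫ hV.fromSpec) (by rw [← map_ker, le_map_iff_comap_le, hker])
  have : IsClosedImmersion (Spec.map (CommRingCat.ofHom
      (Ideal.Quotient.mk ((i.ker.ideal ⟨V, hV⟩).map β)))) :=
    IsClosedImmersion.spec_of_surjective _ Ideal.Quotient.mk_surjective
  exact ⟨z, isPullback_of_isClosedImmersion _ _ _ _ (by simp [z]) hker⟩

open Scheme.IdealSheafData in
-- This links the ideal that defines `m_{f,Z,U}` to the ideal of `𝒵` on `V`, from which the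
-- intersection multiplicities are computed.
theorem pullbackIdeal_eq_map {X Y Z 𝒴 𝒵 : Scheme.{u}} (f : X ⟶ Y) (j : Z ⟶ Y) (g : Y ⟶ 𝒴)
    (i : 𝒵 ⟶ 𝒴) [IsClosedImmersion i] (gZ : Z ⟶ 𝒵) (h : IsPullback j gZ g i)
    {U : X.Opens} (hU : IsAffineOpen U) {V : 𝒴.Opens} (hV : IsAffineOpen V)
    (hUV : U ≤ (f ≫ g) ⁻¹ᵁ V) :
    pullbackIdeal f j ⟨U, hU⟩ = (i.ker.ideal ⟨V, hV⟩).map ((f ≫ g).appLE V U hUV).hom := by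
  have : IsClosedImmersion j := MorphismProperty.of_isPullback h.flip ‹_›
  have hj : j.ker = i.ker.comap g := by
    rw [← ker_fst_of_isClosedImmersion, ← h.isoPullback_hom_fst, Scheme.Hom.ker_comp_of_isIso]
  rw [pullbackIdeal, ← specIdeal_comap_fromSpec, ker_fst_of_isClosedImmersion, hj, ← comap_comp,
    ← comap_comp, Category.assoc, ← IsAffineOpen.SpecMap_appLE_fromSpec (f ≫ g) hV hU hUV, comap_comp,
    specIdeal_comap, specIdeal_comap_fromSpec]

/-! ### Ultraproducts of valuation rings -/

section Ultraproduct

variable {S k : Type*} [Field k] (l : Ultrafilter S) {A : S → Type*} [∀ s, CommRing (A s)]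
  (ι : ∀ s, A s →+* k)

/-- The ring homomorphism from the product of a family of subrings of `k` to an ultrapower of
`k`. -/
def ultraproductMap : (∀ s, A s) →+* (l : Filter S).Germ k where
  toFun a := ((fun s => ι s (a s) : S → k) : (l : Filter S).Germ k)
  map_one' := by simp; rfl
  map_mul' a b := by simp; rfl
  map_zero' := by simp; rfl
  map_add' a b := by simp; rfl

theorem coe_mem_range_ultraproductMap {f : S → k} :
    (f : (l : Filter S).Germ k) ∈ (ultraproductMap l ι).range ↔ ∀ᶠ s in l, f s ∈ (ι s).range := by
  constructor
  · rintro ⟨a, ha⟩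
    filter_upwards [Germ.coe_eq.1 ha] with s hs using ⟨a s, hs⟩
  · intro h
    choose! a ha using fun s (hs : f s ∈ (ι s).range) => hs
    exact ⟨a, Germ.coe_eq.2 (h.mono ha)⟩

/-- The ultraproduct of a family of valuation rings of `k`, as a valuation ring of an ultrapower
of `k`. -/
def ultraproductValuationSubring (h : ∀ s (x : k), x ∈ (ι s).range ∨ x⁻¹ ∈ (ι s).range) :
    ValuationSubring ((l : Filter S).Germ k) :=
  ValuationSubring.ofSubring (ultraproductMap l ι).range fun x => by
    induction x using Germ.inductionOn with
    | _ f =>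
      have h' : ((f : (l : Filter S).Germ k))⁻¹ = ((fun s => (f s)⁻¹ : S → k)) := rfl
      -- An ultrafilter is prime: a disjunction that holds almost everywhere has a disjunct that
      -- holds almost everywhere.
      rw [h', coe_mem_range_ultraproductMap, coe_mem_range_ultraproductMap, ← l.eventually_or]
      exact .of_forall fun s => h s _

variable {l ι} (h : ∀ s (x : k), x ∈ (ι s).range ∨ x⁻¹ ∈ (ι s).range)

theorem coe_mem_ultraproductValuationSubring {f : S → k} :
    (f : (l : Filter S).Germ k) ∈ ultraproductValuationSubring l ι h ↔
      ∀ᶠ s in l, f s ∈ (ι s).range :=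
  coe_mem_range_ultraproductMap l ι

theorem eventually_isUnit_of_ultraproductMap_eq (hι : ∀ s, Function.Injective (ι s))
    {z : ultraproductValuationSubring l ι h} (hz : IsUnit z) {a : ∀ s, A s}
    (ha : (z : (l : Filter S).Germ k) = ultraproductMap l ι a) : ∀ᶠ s in l, IsUnit (a s) := by
  obtain ⟨w, hw⟩ := hz.exists_right_inv
  obtain ⟨b, hb⟩ := w.2
  have : ultraproductMap l ι (a * b) = ultraproductMap l ι 1 := by
    rw [map_mul, map_one, ← ha, hb]
    exact congr_arg Subtype.val hw
  filter_upwards [Germ.coe_eq.1 this] with s hs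
  exact IsUnit.of_mul_eq_one (b s) (hι s hs)

/-- An element of the maximal ideal is the germ of a family of nonunits, since pointwise inverses on
a large set would give an inverse. Sums and products of such families then represent the elements of
the powers. -/
theorem exists_eq_ultraproductMap_of_mem_maximalIdeal_pow [∀ s, IsLocalRing (A s)]
    {z : ultraproductValuationSubring l ι h} {n : ℕ} (hz : z ∈ IsLocalRing.maximalIdeal _ ^ n) :
    ∃ a : ∀ s, A s, (∀ s, a s ∈ IsLocalRing.maximalIdeal (A s) ^ n) ∧
      (z : (l : Filter S).Germ k) = ultraproductMap l ι a := by
  classical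
  induction hz using Submodule.pow_induction_on_left' with
  | algebraMap r =>
    obtain ⟨a, ha⟩ := r.2
    exact ⟨a, by simp, ha.symm⟩
  | add x y i hx hy ihx ihy =>
    obtain ⟨a, ha, ha'⟩ := ihx
    obtain ⟨b, hb, hb'⟩ := ihy
    exact ⟨a + b, fun s => add_mem (ha s) (hb s), by rw [map_add, ← ha', ← hb']; rfl⟩
  | mem_mul m hm i x hx ih =>
    obtain ⟨b, hb, hb'⟩ := ih
    obtain ⟨a, ha⟩ := m.2
    have hu : ∀ᶠ s in l, ¬ IsUnit (a s) := by
      rw [Ultrafilter.eventually_not]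
      intro hu
      refine (IsLocalRing.mem_maximalIdeal _).1 hm ?_
      choose! c hc using fun s (hs : IsUnit (a s)) => hs.exists_right_inv
      refine IsUnit.of_mul_eq_one ⟨ultraproductMap l ι c, c, rfl⟩ (Subtype.ext ?_)
      change (m : (l : Filter S).Germ k) * ultraproductMap l ι c = 1
      rw [← ha, ← map_mul, ← map_one (ultraproductMap l ι)]
      refine Germ.coe_eq.2 (hu.mono fun s hs => ?_)
      simp [hc s hs]
    -- Resetting `a s` to `0` at the negligible set of `s` where it is a unit puts it in the maximal
    -- ideal for every `s` without changing the germ.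
    refine ⟨fun s => (if IsUnit (a s) then 0 else a s) * b s, fun s => ?_, ?_⟩
    · rw [pow_succ']
      refine Ideal.mul_mem_mul ?_ (hb s)
      split_ifs with hs
      · exact zero_mem _
      · exact hs
    · change (m : (l : Filter S).Germ k) * x = _
      rw [← ha, hb', ← map_mul]
      refine Germ.coe_eq.2 (hu.mono fun s hs => ?_)
      simp [hs]

end Ultraproduct

/-! ### Localizations of a Dedekind domain inside its fraction field -/

section Dedekind
variable {R k : Type u} [CommRing R] [IsDedekindDomain R] [Field k] [Algebra R k]
  [IsFractionRing R k] (𝔪 : MaximalSpectrum R)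

theorem localizationToFractionField_algebraMap (r : R) :
    localizationToFractionField R k 𝔪 (algebraMap R _ r) = algebraMap R k r :=
  IsLocalization.lift_eq _ _

theorem localizationToFractionField_injective :
    Function.Injective (localizationToFractionField R k 𝔪) :=
  (IsLocalization.lift_injective_iff _).2 fun x y => by
    rw [(IsLocalization.injective _ 𝔪.asIdeal.primeCompl_le_nonZeroDivisors).eq_iff,
      (IsFractionRing.injective R k).eq_iff]

theorem isPrincipalIdealRing_localization :
    IsPrincipalIdealRing (Localization.AtPrime 𝔪.asIdeal) :=
  have := IsLocalization.AtPrime.isDedekindDomain R 𝔪.asIdeal (Localization.AtPrime 𝔪.asIdeal)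
  inferInstance

theorem mem_range_or_inv_mem_range_localizationToFractionField (x : k) :
    x ∈ (localizationToFractionField R k 𝔪).range ∨
      x⁻¹ ∈ (localizationToFractionField R k 𝔪).range := by
  have := IsLocalization.AtPrime.isDedekindDomain R 𝔪.asIdeal (Localization.AtPrime 𝔪.asIdeal)
  have := isPrincipalIdealRing_localization 𝔪
  have : ValuationRing (Localization.AtPrime 𝔪.asIdeal) :=
    ValuationRing.iff_local_bezout_domain.2 ⟨inferInstance, inferInstance⟩
  obtain ⟨a, b, hb, rfl⟩ := IsFractionRing.div_surjective (A := R) x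
  have hb' := IsFractionRing.to_map_ne_zero_of_mem_nonZeroDivisors (K := k) hb
  obtain ha | ha := eq_or_ne (algebraMap R k a) 0
  · exact .inl (by simp [ha, zero_mem])
  obtain ⟨c, hc⟩ := ValuationRing.cond (algebraMap R (Localization.AtPrime 𝔪.asIdeal) a)
    (algebraMap R _ b)
  replace hc := hc.imp (congr_arg (localizationToFractionField R k 𝔪))
    (congr_arg (localizationToFractionField R k 𝔪))
  simp only [map_mul, localizationToFractionField_algebraMap] at hc
  obtain hc | hc := hc
  · exact .inr ⟨c, by rw [inv_div, ← hc, mul_div_cancel_left₀ _ ha]⟩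
  · exact .inl ⟨c, by rw [← hc, mul_div_cancel_left₀ _ hb']⟩

/-- By unique factorization, the nonzero ideal `(b)` has only finitely many divisors. -/
theorem finite_setOf_mem_maximalSpectrum {b : R} (hb : b ≠ 0) :
    {𝔪 : MaximalSpectrum R | b ∈ 𝔪.asIdeal}.Finite := by
  have hI : Ideal.span {b} ≠ 0 := by simpa using hb
  have := UniqueFactorizationMonoid.fintypeSubtypeDvd _ hI
  have hfin : {I : Ideal R | I ∣ Ideal.span {b}}.Finite :=
    Set.finite_coe_iff.1 (@Finite.of_fintype _ this)
  refine Set.Finite.of_finite_image (f := MaximalSpectrum.asIdeal)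
    (hfin.subset ?_)
    fun x _ y _ hxy => MaximalSpectrum.ext hxy
  rintro _ ⟨𝔪, h𝔪, rfl⟩
  exact Ideal.dvd_span_singleton.2 h𝔪

/-- Only the maximal ideals containing a denominator of `x` can occur. This is what places `k`
inside the ultraproduct of the localizations. -/
theorem finite_setOf_notMem_range_localizationToFractionField (x : k) :
    {𝔪 : MaximalSpectrum R | x ∉ (localizationToFractionField R k 𝔪).range}.Finite := by
  obtain ⟨a, b, hb, rfl⟩ := IsFractionRing.div_surjective (A := R) x
  refine (finite_setOf_mem_maximalSpectrum (nonZeroDivisors.ne_zero hb)).subset fun 𝔪 h𝔪 => ?_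
  by_contra hb'
  refine h𝔪 ⟨IsLocalization.mk' _ a (⟨b, hb'⟩ : 𝔪.asIdeal.primeCompl), ?_⟩
  rw [localizationToFractionField, IsLocalization.lift_mk'_spec,
    mul_div_cancel₀ _ (IsFractionRing.to_map_ne_zero_of_mem_nonZeroDivisors hb)]

end Dedekind

/-! ### Ultraproducts of rational points in affine charts -/

namespace AlgebraicGeometry

theorem exists_eq_SpecMap_comp_fromSpec {X : Scheme.{u}} {A : CommRingCat.{u}} [IsLocalRing A]
    (x : Spec A ⟶ X) {U : X.Opens} (hU : IsAffineOpen U)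
    (hx : x (IsLocalRing.closedPoint A) ∈ U) :
    ∃ φ : Γ(X, U) ⟶ A, x = Spec.map φ ≫ hU.fromSpec := by
  have h : x ⁻¹ᵁ U = ⊤ := Scheme.preimage_eq_top_of_closedPoint_mem x hx
  have hr : Set.range x ⊆ Set.range hU.fromSpec := by
    rw [hU.range_fromSpec]
    rintro _ ⟨z, rfl⟩
    exact h.ge (TopologicalSpace.Opens.mem_top z)
  exact ⟨Spec.preimage (IsOpenImmersion.lift hU.fromSpec x hr), by simp⟩

theorem SpecMap_comp_fromSpec_mem_basicOpen_iff {X : Scheme.{u}} {A : CommRingCat.{u}}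
    [IsLocalRing A] {U : X.Opens} (hU : IsAffineOpen U) (φ : Γ(X, U) ⟶ A) (g : Γ(X, U)) :
    (Spec.map φ ≫ hU.fromSpec) (IsLocalRing.closedPoint A) ∈ X.basicOpen g ↔ IsUnit (φ g) := by
  change Spec.map φ (IsLocalRing.closedPoint A) ∈ hU.fromSpec ⁻¹ᵁ X.basicOpen g ↔ _
  rw [hU.fromSpec_preimage_basicOpen, ← not_iff_not]
  exact not_not.trans (IsLocalRing.mem_maximalIdeal _)

theorem apply_eq_of_SpecMap_comp_fromSpec_eq {X : Scheme.{u}} {A : CommRingCat.{u}}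
    {U W : X.Opens} (hU : IsAffineOpen U) (hW : IsAffineOpen W) (h : W ≤ U)
    {φ : Γ(X, U) ⟶ A} {φ' : Γ(X, W) ⟶ A}
    (hφ : Spec.map φ ≫ hU.fromSpec = Spec.map φ' ≫ hW.fromSpec) (a : Γ(X, U)) :
    φ a = φ' (X.presheaf.map (homOfLE h).op a) := by
  rw [← hU.map_fromSpec hW (homOfLE h).op, ← Spec.map_comp_assoc, cancel_mono] at hφ
  exact congr($(Spec.map_injective hφ) a)

/-- Let `x s` be a family of `k`-valued points of `X` indexed by a set with an ultrafilter `l`.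
This says that almost all of them lie in the affine open subset `U`, and that `ψ` is the
ultraproduct of their evaluation maps. -/
def IsUltraEval {S k : Type u} [Field k] (l : Ultrafilter S) {X : Scheme.{u}}
    (x : S → (Spec (.of k) ⟶ X)) {U : X.Opens} (hU : IsAffineOpen U)
    (ψ : Γ(X, U) ⟶ .of ((l : Filter S).Germ k)) : Prop :=
  ∃ F : S → Γ(X, U) → k,
    (∀ᶠ s in l, ∃ φ : Γ(X, U) ⟶ .of k, x s = Spec.map φ ≫ hU.fromSpec ∧ ∀ a, φ a = F s a) ∧
      ∀ a, ψ a = ((fun s => F s a : S → k) : (l : Filter S).Germ k)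

section

variable {S k : Type u} [Field k] {l : Ultrafilter S} {X : Scheme.{u}}
  {x : S → (Spec (.of k) ⟶ X)}

theorem exists_isUltraEval {U : X.Opens} (hU : IsAffineOpen U)
    (h : ∀ᶠ s in l, x s (IsLocalRing.closedPoint k) ∈ U) : ∃ ψ, IsUltraEval l x hU ψ := by
  classical
  choose φ hφ using fun s (hs : x s (IsLocalRing.closedPoint k) ∈ U) =>
    exists_eq_SpecMap_comp_fromSpec (x s) hU hs
  -- The value `0` is used for the negligible set of `s` whose point lies outside `U`.
  let F : S → Γ(X, U) → k := fun s a => if hs : _ then φ s hs a else 0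
  have hF : ∀ s hs a, F s a = φ s hs a := fun s hs a => dif_pos hs
  refine ⟨CommRingCat.ofHom
    { toFun := fun a => ((fun s => F s a : S → k) : (l : Filter S).Germ k)
      map_one' := Germ.coe_eq.2 ?_
      map_mul' := fun a b => Germ.coe_eq.2 ?_
      map_zero' := Germ.coe_eq.2 ?_
      map_add' := fun a b => Germ.coe_eq.2 ?_ }, F,
    h.mono fun s hs => ⟨φ s hs, hφ s hs, fun a => (hF s hs a).symm⟩, fun a => rfl⟩ <;>
  · filter_upwards [h] with s hs
    simp [hF s hs]

/-- The ultraproduct of the points does not depend on the chart. Near the `K`-point both charts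
contain a common basic open set `D(g)`, on which each function `b` of the second chart is a fraction
`c / g ^ n` from the first. Evaluation at the `K`-point and at almost all `x s` respects this
fraction. -/
theorem IsUltraEval.of_eq {U U' : X.Opens} {hU : IsAffineOpen U} {hU' : IsAffineOpen U'} {ψ ψ'}
    (h : IsUltraEval l x hU ψ) (hψ : Spec.map ψ ≫ hU.fromSpec = Spec.map ψ' ≫ hU'.fromSpec) :
    IsUltraEval l x hU' ψ' := by
  classical
  obtain ⟨F, hF, hψF⟩ := h
  let η : Spec (.of ((l : Filter S).Germ k)) := IsLocalRing.closedPoint ((l : Filter S).Germ k)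
  have memU : ∀ {U : X.Opens} (hU : IsAffineOpen U) ψ, (Spec.map ψ ≫ hU.fromSpec) η ∈ U := by
    intro U hU ψ
    rw [← SetLike.mem_coe, ← hU.range_fromSpec]
    exact ⟨_, rfl⟩
  obtain ⟨g, g', hgg', hηg⟩ := exists_basicOpen_le_affine_inter hU hU'
    ((Spec.map ψ ≫ hU.fromSpec) η) ⟨memU hU ψ, hψ ▸ memU hU' ψ'⟩
  have hD := hU.basicOpen g
  have hDU : X.basicOpen g ≤ U := X.basicOpen_le g
  have hDU' : X.basicOpen g ≤ U' := hgg' ▸ X.basicOpen_le g'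
  have hψg : ψ g ≠ 0 := ((SpecMap_comp_fromSpec_mem_basicOpen_iff
    (A := .of ((l : Filter S).Germ k)) hU ψ g).1 hηg).ne_zero
  have hFg : ∀ᶠ s in l, F s g ≠ 0 := by
    rw [Ultrafilter.eventually_not]
    intro h
    exact hψg ((hψF g).trans (Germ.coe_eq.2 h))
  have hmem : ∀ᶠ s in l, x s (IsLocalRing.closedPoint k) ∈ X.basicOpen g := by
    filter_upwards [hF, hFg] with s hs hsg
    obtain ⟨φ, hφ, hφF⟩ := hs
    rw [hφ]
    refine (SpecMap_comp_fromSpec_mem_basicOpen_iff (A := .of k) hU φ g).2 ?_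
    exact (hφF g ▸ hsg : φ g ≠ 0).isUnit
  have hfrac : ∀ b : Γ(X, U'), ∃ (n : ℕ) (c : Γ(X, U)),
      X.presheaf.map (homOfLE hDU').op b * X.presheaf.map (homOfLE hDU).op (g ^ n) =
        X.presheaf.map (homOfLE hDU).op c := by
    intro b
    have := hU.isLocalization_basicOpen g
    obtain ⟨⟨c, ⟨_, n, rfl⟩⟩, hc⟩ := IsLocalization.surj (Submonoid.powers g)
      (X.presheaf.map (homOfLE hDU').op b)
    exact ⟨n, c, hc⟩
  have compare : ∀ {A : CommRingCat.{u}} [IsLocalRing A] (φ : Γ(X, U) ⟶ A) (φ' : Γ(X, U') ⟶ A),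
      Spec.map φ ≫ hU.fromSpec = Spec.map φ' ≫ hU'.fromSpec →
      (Spec.map φ ≫ hU.fromSpec) (IsLocalRing.closedPoint A) ∈ X.basicOpen g →
      ∀ (n : ℕ) (c : Γ(X, U)) (b : Γ(X, U')),
      X.presheaf.map (homOfLE hDU').op b * X.presheaf.map (homOfLE hDU).op (g ^ n) =
        X.presheaf.map (homOfLE hDU).op c → φ' b * φ g ^ n = φ c := by
    intro A _ φ φ' hφ hmem n c b hc
    obtain ⟨φD, hφD⟩ := exists_eq_SpecMap_comp_fromSpec _ hD hmem
    rw [← map_pow, apply_eq_of_SpecMap_comp_fromSpec_eq hU hD hDU hφD,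
      apply_eq_of_SpecMap_comp_fromSpec_eq hU hD hDU hφD,
      apply_eq_of_SpecMap_comp_fromSpec_eq hU' hD hDU' (hφ.symm.trans hφD), ← map_mul, hc]
  choose φ hφ using fun s (hs : x s (IsLocalRing.closedPoint k) ∈ U') =>
    exists_eq_SpecMap_comp_fromSpec (x s) hU' hs
  let F' : S → Γ(X, U') → k := fun s a => if hs : _ then φ s hs a else 0
  have hF' : ∀ s hs a, F' s a = φ s hs a := fun s hs a => dif_pos hs
  refine ⟨F', hmem.mono fun s hs =>
    ⟨φ s (hDU' hs), hφ s _, fun a => (hF' s (hDU' hs) a).symm⟩, fun b => ?_⟩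
  obtain ⟨n, c, hc⟩ := hfrac b
  have h₁ : ψ' b * ψ g ^ n = ψ c :=
    compare (A := .of ((l : Filter S).Germ k)) ψ ψ' hψ hηg n c b hc
  refine mul_right_cancel₀ (pow_ne_zero n hψg) (h₁.trans ?_)
  rw [hψF, hψF]
  refine Germ.coe_eq.2 ?_
  filter_upwards [hF, hmem] with s hs hsD
  obtain ⟨φ₀, hφ₀, hφF⟩ := hs
  have h₂ : φ s (hDU' hsD) b * φ₀ g ^ n = φ₀ c :=
    compare (A := .of k) φ₀ _ (hφ₀.symm.trans (hφ s (hDU' hsD))) (hφ₀ ▸ hsD) n c b hc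
  change F s c = F' s b * F s g ^ n
  rw [← hφF, ← hφF, hF' s (hDU' hsD), ← h₂]

end

end AlgebraicGeometry

/-! ### From extended ideals to Campana points -/

theorem isPullback_localInclusion {R : Type u} [CommRing R] {𝒴 𝒵 : Scheme.{u}}
    (π : 𝒴 ⟶ Spec (CommRingCat.of R)) (i : 𝒵 ⟶ 𝒴) (𝔪 : MaximalSpectrum R) :
    IsPullback (localInclusion π i 𝔪) (pullback.fst _ _) (pullback.fst _ _) i := by
  refine (IsPullback.of_bot ?_ (pullback.lift_fst _ _ _).symm (IsPullback.of_hasPullback π _)).flip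
  have h : localInclusion π i 𝔪 ≫ pullback.snd _ _ = pullback.snd _ _ :=
    (pullback.lift_snd _ _ _).trans (Category.comp_id _)
  rw [h]
  exact IsPullback.of_hasPullback _ _

theorem HasIntersectionMultiplicity.of_isPullback {A : Type u} [CommRing A] [IsLocalRing A]
    {𝒴 𝒵 : Scheme.{u}} {y : Spec (CommRingCat.of A) ⟶ 𝒴} {i : 𝒵 ⟶ 𝒴} {n : ℕ} {z}
    (h : IsPullback (Spec.map (CommRingCat.ofHom
      (Ideal.Quotient.mk (IsLocalRing.maximalIdeal A ^ n)))) z y i) :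
    HasIntersectionMultiplicity y i n :=
  ⟨Over.isoMk h.isoPullback.symm (by simp)⟩

/-- The intersection of `𝒵_𝔪` with the point given by `β` is cut out by the extended ideal, so
membership becomes a condition on this ideal alone. -/
theorem exists_mem_campanaPoints {R : Type u} [CommRing R] {𝒴 𝒵 : Scheme.{u}}
    (π : 𝒴 ⟶ Spec (CommRingCat.of R)) (i : 𝒵 ⟶ 𝒴) [IsClosedImmersion i] (𝔪 : MaximalSpectrum R)
    {V : 𝒴.Opens} (hV : IsAffineOpen V)
    (β : Γ(𝒴, V) →+* Localization.AtPrime 𝔪.asIdeal)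
    (hβ : Spec.map (CommRingCat.ofHom β) ≫ hV.fromSpec ≫ π = specAlgebraMap R _) {N : ℕ∞}
    (hN : (i.ker.ideal ⟨V, hV⟩).map β = ⊥ ∨ ∃ n : ℕ, (i.ker.ideal ⟨V, hV⟩).map β =
      IsLocalRing.maximalIdeal (Localization.AtPrime 𝔪.asIdeal) ^ n ∧ (n = 0 ∨ N ≤ n)) :
    ∃ y ∈ campanaPoints (localModel π 𝔪) (localInclusion π i 𝔪) N,
      y ≫ pullback.fst _ _ = Spec.map (CommRingCat.ofHom β) ≫ hV.fromSpec := by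
  let y : Spec (CommRingCat.of (Localization.AtPrime 𝔪.asIdeal)) ⟶
      pullback π (specAlgebraMap R (Localization.AtPrime 𝔪.asIdeal)) :=
    pullback.lift (Spec.map (CommRingCat.ofHom β) ≫ hV.fromSpec) (𝟙 _) (by simpa using hβ)
  have hy : y ≫ pullback.fst _ _ = Spec.map (CommRingCat.ofHom β) ≫ hV.fromSpec := pullback.lift_fst _ _ _
  refine ⟨y, ⟨pullback.lift_snd _ _ _, ?_⟩, hy⟩
  have hex := exists_isPullback_quotient_map_ideal_ker i hV β
  have hloc := isPullback_localInclusion π i 𝔪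
  generalize (i.ker.ideal ⟨V, hV⟩).map β = I at hN hex
  obtain ⟨z, hz⟩ := hex
  rw [← hy] at hz
  obtain ⟨z', hz'⟩ : ∃ z', IsPullback (Spec.map (CommRingCat.ofHom (Ideal.Quotient.mk I))) z' y
      (localInclusion π i 𝔪) :=
    ⟨hloc.lift (Spec.map (CommRingCat.ofHom (Ideal.Quotient.mk I)) ≫ y) z (by simpa using hz.w),
      (IsPullback.of_right (by simpa using hz.flip) (by simp) hloc.flip).flip⟩
  obtain rfl | ⟨n, rfl, hn⟩ := hN
  -- If the extended ideal is zero, the intersection is all of `Spec R_𝔪`, and the point factors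
  -- through `𝒵_𝔪`.
  · have : IsIso (CommRingCat.ofHom (Ideal.Quotient.mk
        (⊥ : Ideal (Localization.AtPrime 𝔪.asIdeal)))) :=
      (ConcreteCategory.isIso_iff_bijective _).2
        ⟨(RingHom.injective_iff_ker_eq_bot _).2 Ideal.mk_ker, Ideal.Quotient.mk_surjective⟩
    refine .inl ⟨inv (Spec.map (CommRingCat.ofHom (Ideal.Quotient.mk ⊥))) ≫ z', ?_⟩
    rw [Category.assoc, ← hz'.w, IsIso.inv_hom_id_assoc]
  · exact .inr ⟨n, .of_isPullback hz', hn⟩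

/-- A family of `k`-points of a proper `k`-scheme, indexed by a set with an ultrafilter `l`, has
an ultraproduct with values in any valuation ring of the ultrapower of `k` that contains `k`. -/
theorem exists_isUltraEval_of_isProper {S k : Type u} [Field k] {l : Ultrafilter S}
    {X : Scheme.{u}} (π : X ⟶ Spec (CommRingCat.of k)) [IsProper π]
    {x : S → (Spec (CommRingCat.of k) ⟶ X)} (hx : ∀ s, x s ∈ sectionPoints π)
    (O : ValuationSubring ((l : Filter S).Germ k))
    (hO : ∀ c : k, ((fun _ => c : S → k) : (l : Filter S).Germ k) ∈ O) :
    ∃ x₀ : X, ∀ (U : X.Opens) (hU : IsAffineOpen U), x₀ ∈ U →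
      ∃ ψ : Γ(X, U) →+* O, IsUltraEval l x hU (CommRingCat.ofHom (O.subtype.comp ψ)) := by
  have : CompactSpace X := (quasiCompact_iff_compactSpace π).1 inferInstance
  obtain ⟨U₀, hU₀, hxU₀⟩ : ∃ (U : X.Opens), IsAffineOpen U ∧
      ∀ᶠ s in l, x s (IsLocalRing.closedPoint k) ∈ U := by
    -- Among finitely many affine charts, the ultrafilter selects one that contains almost all the
    -- points.
    let 𝒰 := X.affineCover.finiteSubcover
    have h : ∀ᶠ s in l, ∃ i : 𝒰.I₀, x s (IsLocalRing.closedPoint k) ∈ (𝒰.f i).opensRange :=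
      .of_forall fun s => by
        obtain ⟨i, y, hy⟩ := 𝒰.exists_eq (x s (IsLocalRing.closedPoint k))
        exact ⟨i, y, hy⟩
    rw [Ultrafilter.eventually_exists_iff] at h
    obtain ⟨i, hi⟩ := h
    exact ⟨_, isAffineOpen_opensRange _, hi⟩
  obtain ⟨ψ₀, hψ₀⟩ := exists_isUltraEval hU₀ hxU₀
  let c : k →+* O :=
    { toFun := fun c => ⟨((fun _ => c : S → k) : (l : Filter S).Germ k), hO c⟩
      map_one' := rfl
      map_mul' := fun _ _ => rfl
      map_zero' := rfl
      map_add' := fun _ _ => rfl }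
  have hsq : (Spec.map ψ₀ ≫ hU₀.fromSpec) ≫ π =
      Spec.map (CommRingCat.ofHom (algebraMap O ((l : Filter S).Germ k))) ≫
        Spec.map (CommRingCat.ofHom c) := by
    obtain ⟨ρ, hρ⟩ : ∃ ρ, hU₀.fromSpec ≫ π = Spec.map ρ := 
      ⟨Spec.preimage (hU₀.fromSpec ≫ π), (Spec.map_preimage _).symm⟩
    rw [Category.assoc, hρ, ← Spec.map_comp, ← Spec.map_comp]
    congr 1
    ext a
    obtain ⟨F, hF, hψF⟩ := hψ₀
    refine (hψF (ρ a)).trans (Germ.coe_eq.2 ?_)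
    filter_upwards [hF] with s hs
    obtain ⟨φ, hφ, hφF⟩ := hs
    have h := hx s
    rw [sectionPoints, Set.mem_ofPred_eq, hφ, Category.assoc, hρ, ← Spec.map_comp,
      ← Spec.map_id, Spec.map_inj] at h
    rw [← hφF]
    exact congr($h a)
  -- The existence half of the valuative criterion extends the `K`-point over `O`; `x₀` is the image
  -- of the closed point.
  have hπ : UniversallyClosed π := inferInstance
  rw [UniversallyClosed.eq_valuativeCriterion] at hπ
  obtain ⟨L, hL, -⟩ := (hπ.1 { R := O, K := (l : Filter S).Germ k, commSq := ⟨hsq⟩, .. }).exists_lift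
  dsimp only at hL
  refine ⟨L (IsLocalRing.closedPoint O), fun U hU hxU => ?_⟩
  obtain ⟨ψ, hψ⟩ := exists_eq_SpecMap_comp_fromSpec (A := .of O) L hU hxU
  refine ⟨ψ.hom, hψ₀.of_eq ?_⟩
  rw [← hL, hψ, ← Category.assoc, ← Spec.map_comp]
  rfl

theorem RingHom.exists_comp_eq_of_forall_mem_range {A B C : Type*} [CommRing A] [CommRing B]
    [CommRing C] {ι : A →+* C} (hι : Function.Injective ι) (φ : B →+* C)
    (h : ∀ b, φ b ∈ ι.range) : ∃ β : B →+* A, ι.comp β = φ := by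
  let e := RingEquiv.ofBijective ι.rangeRestrict
    ⟨fun x y hxy => hι (congr_arg Subtype.val hxy), ι.rangeRestrict_surjective⟩
  refine ⟨e.symm.toRingHom.comp (φ.codRestrict ι.range h), RingHom.ext fun b => ?_⟩
  exact congr_arg Subtype.val (e.apply_symm_apply (φ.codRestrict ι.range h b))

/-! ### Transfer of ideals between the ultraproduct and its factors -/

section Ultraproduct

variable {S k : Type*} [Field k] {l : Ultrafilter S} {A : S → Type*} [∀ s, CommRing (A s)]
  {ι : ∀ s, A s →+* k}
  (h : ∀ s (x : k), x ∈ (ι s).range ∨ x⁻¹ ∈ (ι s).range)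

/-- If the ideal `J` generates the unit ideal in the ultraproduct of the local rings `A s`, then
it generates the unit ideal in almost all of them. -/
theorem eventually_map_eq_top (hι : ∀ s, Function.Injective (ι s))
    {B C : Type*} [CommRing B] [CommRing C] {J : Ideal B} {θ : B →+* C}
    {ψ : C →+* ultraproductValuationSubring l ι h} {F : S → C → k}
    (hF : ∀ a, (ψ a : (l : Filter S).Germ k) = ((fun s => F s a : S → k)))
    (hJ : ¬ J.map θ ≤ (IsLocalRing.maximalIdeal _).comap ψ) :
    ∀ᶠ s in l, ∀ β : B →+* A s, (∀ b, ι s (β b) = F s (θ b)) → J.map β = ⊤ := by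
  rw [Ideal.map_le_iff_le_comap, SetLike.not_le_iff_exists] at hJ
  obtain ⟨t, ht, ht'⟩ := hJ
  have hu : IsUnit (ψ (θ t)) := by
    by_contra hu
    exact ht' hu
  obtain ⟨a, ha⟩ := (ψ (θ t)).2
  filter_upwards [eventually_isUnit_of_ultraproductMap_eq h hι hu ha.symm,
    Germ.coe_eq.1 (ha.trans (hF (θ t)))] with s hs hs' β hβ
  refine Ideal.eq_top_of_isUnit_mem _ (Ideal.mem_map_of_mem β ht) ?_
  rwa [← hι s (hs'.trans (hβ t).symm)]

/-- The containment is tested on finitely many generators of `J`, each of which satisfies it for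
almost all `s`. -/
theorem eventually_map_le_maximalIdeal_pow [∀ s, IsLocalRing (A s)]
    (hι : ∀ s, Function.Injective (ι s)) {B C : Type*} [CommRing B] [CommRing C] {J : Ideal B}
    (hJfg : J.FG) {θ : B →+* C}
    {ψ : C →+* ultraproductValuationSubring l ι h} {F : S → C → k}
    (hF : ∀ a, (ψ a : (l : Filter S).Germ k) = ((fun s => F s a : S → k))) {n : ℕ}
    (hJ : (J.map θ).map ψ ≤ IsLocalRing.maximalIdeal _ ^ n) :
    ∀ᶠ s in l, ∀ β : B →+* A s, (∀ b, ι s (β b) = F s (θ b)) →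
      J.map β ≤ IsLocalRing.maximalIdeal (A s) ^ n := by
  obtain ⟨T, rfl⟩ := hJfg
  have hT : ∀ t ∈ T, ∀ᶠ s in l, ∀ β : B →+* A s, (∀ b, ι s (β b) = F s (θ b)) →
      β t ∈ IsLocalRing.maximalIdeal (A s) ^ n := by
    intro t ht
    obtain ⟨a, ha, ha'⟩ := exists_eq_ultraproductMap_of_mem_maximalIdeal_pow h
      (hJ (Ideal.mem_map_of_mem _ (Ideal.mem_map_of_mem _ (Ideal.subset_span ht))))
    filter_upwards [Germ.coe_eq.1 (ha'.symm.trans (hF (θ t)))] with s hs β hβ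
    rw [← hι s (hs.trans (hβ t).symm)]
    exact ha s
  rw [← eventually_all_finset] at hT
  filter_upwards [hT] with s hs β hβ
  rw [Ideal.map_span, Ideal.span_le]
  rintro _ ⟨t, ht, rfl⟩
  exact hs t ht β hβ

/-- The alternative is whether the closed point of the ultraproduct maps into the locus of `J`. If
so, a minimal prime `p` of the extended ideal lies in the preimage of the maximal ideal, and
containment in `p ^ n` passes to the `n`-th power of that maximal ideal and then to almost all
factors. Otherwise the extended ideal is the unit ideal in almost all factors. -/
theorem eventually_map_eq_bot_or_eq_maximalIdeal_pow [∀ s, IsDomain (A s)]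
    [∀ s, IsLocalRing (A s)] [∀ s, IsPrincipalIdealRing (A s)]
    (hι : ∀ s, Function.Injective (ι s)) {B C : Type*} [CommRing B] [CommRing C]
    [IsDomain C] [IsNoetherianRing C] {J : Ideal B} (hJfg : J.FG) {θ : B →+* C}
    {ψ : C →+* ultraproductValuationSubring l ι h} {F : S → C → k}
    (hF : ∀ a, (ψ a : (l : Filter S).Germ k) = ((fun s => F s a : S → k)))
    (hF₀ : ∀ᶠ s in l, F s 0 = 0) {N : ℕ∞}
    (hN : J.map θ ≠ ⊤ → ∀ p ∈ (J.map θ).minimalPrimes,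
      N ≤ ⨆ e ∈ {e : ℕ | J.map θ ≤ p ^ e}, (e : ℕ∞)) :
    ∀ᶠ s in l, ∀ β : B →+* A s, (∀ b, ι s (β b) = F s (θ b)) →
      J.map β = ⊥ ∨ ∃ n : ℕ, J.map β = IsLocalRing.maximalIdeal (A s) ^ n ∧ (n = 0 ∨ N ≤ n) := by
  by_cases hJ : J.map θ ≤ (IsLocalRing.maximalIdeal _).comap ψ
  · obtain ⟨p, hp, hpψ⟩ := Ideal.exists_minimalPrimes_le hJ
    have hp' : p.IsPrime := hp.1.1
    replace hN := hN (ne_top_of_le_ne_top (Ideal.IsPrime.ne_top inferInstance) hJ) p hp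
    induction N with
    | top =>
      have hle : ∀ n : ℕ, J.map θ ≤ p ^ n := by
        intro n
        obtain ⟨e, he, hne⟩ : ∃ e ∈ {e : ℕ | J.map θ ≤ p ^ e}, (n : ℕ∞) < e := by
          simpa only [lt_iSup_iff, exists_prop] using (ENat.natCast_lt_top n).trans_le hN
        exact he.trans (Ideal.pow_le_pow_right (by exact_mod_cast hne.le))
      -- Krull's intersection theorem in the Noetherian domain `C`.
      have hbot : J.map θ = ⊥ :=
        le_bot_iff.1 ((le_iInf hle).trans (Ideal.iInf_pow_eq_bot_of_isDomain p hp'.ne_top).le)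
      filter_upwards [hF₀] with s hs β hβ
      refine .inl (le_bot_iff.1 (Ideal.map_le_iff_le_comap.2 fun b hb => ?_))
      have : θ b = 0 := by
        rw [← Ideal.mem_bot, ← hbot]
        exact Ideal.mem_map_of_mem _ hb
      exact hι s (by rw [hβ, this, hs, map_zero])
    | coe n =>
      have hle : J.map θ ≤ p ^ n := by
        -- For `n > 0`, an exponent `e > n - 1` below the supremum suffices; `n = 0` is separate
        -- because `n - 1` is truncated.
        obtain rfl | hn := Nat.eq_zero_or_pos n
        · simp
        obtain ⟨e, he, hne⟩ : ∃ e ∈ {e : ℕ | J.map θ ≤ p ^ e}, ((n - 1 : ℕ) : ℕ∞) < e := by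
          simpa only [lt_iSup_iff, exists_prop] using
            (show ((n - 1 : ℕ) : ℕ∞) < n by exact_mod_cast Nat.sub_one_lt_of_lt hn).trans_le hN
        have hne' : n - 1 < e := by exact_mod_cast hne
        exact he.trans (Ideal.pow_le_pow_right (by omega))
      have hle' : (J.map θ).map ψ ≤ IsLocalRing.maximalIdeal _ ^ n := by
        refine (Ideal.map_mono hle).trans ?_
        rw [Ideal.map_pow]
        exact Ideal.pow_right_mono (Ideal.map_le_iff_le_comap.2 hpψ) n
      filter_upwards [eventually_map_le_maximalIdeal_pow h hι hJfg hF hle'] with s hs β hβ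
      refine or_iff_not_imp_left.2 fun hne => ?_
      obtain ⟨m, hm⟩ := exists_maximalIdeal_pow_eq_of_principal (A s)
        (IsPrincipalIdealRing.principal _) _ hne
      obtain hnm | hmn := le_total n m
      · exact ⟨m, hm, .inr (by exact_mod_cast hnm)⟩
      -- Here `m ≤ n`, so the `m`-th and `n`-th powers contain each other, and `n` itself serves as
      -- the exponent.
      · exact ⟨n, (hs β hβ).antisymm (hm ▸ Ideal.pow_le_pow_right hmn), .inr le_rfl⟩
  · filter_upwards [eventually_map_eq_top h hι hF hJ] with s hs β hβ
    exact .inr ⟨0, by simpa using hs β hβ, .inl rfl⟩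

/-- If `ψ` is the ultraproduct of maps to `k` with values in the ultraproduct of the subrings
`A s`, then almost all of these maps send a given finitely generated algebra to `A s`. -/
theorem eventually_forall_mem_range {R B C : Type*} [CommRing R] [CommRing B] [CommRing C]
    {ρ : R →+* B} (hρ : ρ.FiniteType) {θ : B →+* C}
    {ψ : C →+* ultraproductValuationSubring l ι h} {F : S → C → k}
    (hF : ∀ a, (ψ a : (l : Filter S).Germ k) = ((fun s => F s a : S → k))) :
    ∀ᶠ s in l, ∀ φ : B →+* k, (∀ b, φ b = F s (θ b)) → (∀ r, φ (ρ r) ∈ (ι s).range) →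
      ∀ b, φ b ∈ (ι s).range := by
  algebraize [ρ]
  obtain ⟨T, hT⟩ := (inferInstance : Algebra.FiniteType R B)
  have hT' : ∀ t ∈ T, ∀ᶠ s in l, F s (θ t) ∈ (ι s).range := fun t _ =>
    (coe_mem_ultraproductValuationSubring h).1 (hF (θ t) ▸ (ψ (θ t)).2)
  rw [← eventually_all_finset] at hT'
  filter_upwards [hT'] with s hs φ hφ hφρ b
  have hb : b ∈ Algebra.adjoin R (T : Set B) := hT ▸ Algebra.mem_top
  induction hb using Algebra.adjoin_induction with
  | mem t ht => exact hφ t ▸ hs t ht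
  | algebraMap r => exact hφρ r
  | add x y _ _ hx hy => exact map_add φ x y ▸ add_mem hx hy
  | mul x y _ _ hx hy => exact map_mul φ x y ▸ mul_mem hx hy

end Ultraproduct

/-! ### The main theorem -/

theorem isPullback_of_isModel {R k : Type u} [CommRing R] [Field k] [Algebra R k]
    {Y Z 𝒴 𝒵 : Scheme.{u}} {πY : Y ⟶ Spec (CommRingCat.of k)} {π𝒴 : 𝒴 ⟶ Spec (CommRingCat.of R)}
    {gY : Y ⟶ 𝒴} (hY : IsModel R k π𝒴 πY gY) {j : Z ⟶ Y} {i : 𝒵 ⟶ 𝒴} {gZ : Z ⟶ 𝒵}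
    (hZ : IsModel R k (i ≫ π𝒴) (j ≫ πY) gZ) (hij : gZ ≫ i = j ≫ gY) : IsPullback j gZ gY i :=
  (IsPullback.of_bot hZ hij hY).flip

/-- A proper ideal forces `U` to meet `f⁻¹(Z)`, so that `U` takes part in the minimum: otherwise `Z
×_Y U` is empty, its ring of functions is zero, and the ideal is the unit ideal. -/
theorem le_iSup_of_pullbackIdeal_ne_top {X Y Z : Scheme.{u}} (f : X ⟶ Y) (j : Z ⟶ Y)
    [IsClosedImmersion j] (U : X.affineOpens) (hU : pullbackIdeal f j U ≠ ⊤) :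
    ∀ p ∈ (pullbackIdeal f j U).minimalPrimes,
      orbifoldMultiplicity f j ≤ ⨆ e ∈ {e : ℕ | pullbackIdeal f j U ≤ p ^ e}, (e : ℕ∞) := by
  have hmem : ∃ x : X, x ∈ U.1 ∧ f x ∈ Set.range j := by
    by_contra! hx
    have hbot : pullback.fst f j ⁻¹ᵁ U.1 = ⊥ := by
      refine le_bot_iff.1 fun z hz => hx _ hz ⟨pullback.snd f j z, ?_⟩
      rw [← Scheme.Hom.comp_apply, ← Scheme.Hom.comp_apply, pullback.condition]
    have : Subsingleton Γ(pullback f j, pullback.fst f j ⁻¹ᵁ U.1) := by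
      rw [hbot]
      infer_instance
    refine hU ((Ideal.eq_top_iff_one _).2 ?_)
    rw [pullbackIdeal, Scheme.Hom.ker_apply]
    exact Subsingleton.elim _ _
  exact fun p hp => (iInf₂_le U hmem).trans (iInf₂_le p hp)

theorem mainTheorem12
    {R k : Type u} [CommRing R] [IsDedekindDomain R] [Field k] [Algebra R k] [IsFractionRing R k]
    {X Y Z 𝒴 𝒵 : Scheme.{u}} [IsIntegral X] [IsIntegral Y] [IsIntegral Z] [IsIntegral 𝒵]
    -- the proper `k`-varieties `X` and `Y` and the dominant `k`-morphism `f`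
    (πX : X ⟶ Spec (CommRingCat.of k)) (πY : Y ⟶ Spec (CommRingCat.of k))
    [IsProper πX] [IsProper πY]
    (f : X ⟶ Y) (hf : f ≫ πY = πX) [IsDominant f]
    (hred : IsReduced (f.fiber (genericPoint Y)))
    -- the proper `R`-model `𝒴` of `Y`
    (π𝒴 : 𝒴 ⟶ Spec (CommRingCat.of R)) [IsProper π𝒴]
    (gY : Y ⟶ 𝒴) (hY : IsModel R k π𝒴 πY gY)
    -- the closed subscheme `Z` of `Y` and its model, the closed subscheme `𝒵` of `𝒴`
    (j : Z ⟶ Y) [IsClosedImmersion j] (i : 𝒵 ⟶ 𝒴) [IsClosedImmersion i]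
    (gZ : Z ⟶ 𝒵) (hZ : IsModel R k (i ≫ π𝒴) (j ≫ πY) gZ) (hij : gZ ≫ i = j ≫ gY) :
    {𝔪 : MaximalSpectrum R | ¬ ∀ x ∈ sectionPoints πX,
      ∃ y ∈ campanaPoints (localModel π𝒴 𝔪) (localInclusion π𝒴 i 𝔪) (orbifoldMultiplicity f j),
        RestrictsTo π𝒴 gY 𝔪 y (x ≫ f)}.Finite := by
  by_contra hinf
  rw [← Set.Infinite, ← Set.infinite_coe_iff] at hinf
  set S : Set (MaximalSpectrum R) := {𝔪 | _} with hS
  have hbad : ∀ s : S, ∃ x ∈ sectionPoints πX, ∀ y ∈ campanaPoints (localModel π𝒴 s.1)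
      (localInclusion π𝒴 i s.1) (orbifoldMultiplicity f j),
        ¬ RestrictsTo π𝒴 gY s.1 y (x ≫ f) := fun s => by simpa [hS] using s.2
  choose x hx hxy using hbad
  -- The set `S` is infinite, so this ultrafilter can be taken to contain all cofinite sets, which
  -- makes the constants from `k` lie in the ultraproduct.
  let l : Ultrafilter S := hyperfilter S
  let ι : ∀ s : S, Localization.AtPrime s.1.asIdeal →+* k :=
    fun s => localizationToFractionField R k s.1
  have hι : ∀ s, Function.Injective (ι s) := fun s => localizationToFractionField_injective s.1
  have hval : ∀ s (c : k), c ∈ (ι s).range ∨ c⁻¹ ∈ (ι s).range := fun s =>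
    mem_range_or_inv_mem_range_localizationToFractionField s.1
  obtain ⟨x₀, hx₀⟩ := exists_isUltraEval_of_isProper (l := l) πX hx
    (ultraproductValuationSubring l ι hval) fun c => by
      refine (coe_mem_ultraproductValuationSubring hval).2 (hyperfilter_le_cofinite ?_)
      exact (finite_setOf_notMem_range_localizationToFractionField c).preimage
        Subtype.val_injective.injOn
  obtain ⟨V, hV, hxV, -⟩ := exists_isAffineOpen_mem_and_subset (x := (f ≫ gY) x₀) (U := ⊤) trivial
  obtain ⟨U, hU, hxU, hUV⟩ := exists_isAffineOpen_mem_and_subset (x := x₀)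
    (U := (f ≫ gY) ⁻¹ᵁ V) hxV
  obtain ⟨ψ, F, hFφ, hψ⟩ := hx₀ U hU hxU
  have : IsLocallyNoetherian X := LocallyOfFiniteType.isLocallyNoetherian πX
  have : IsLocallyNoetherian 𝒴 := LocallyOfFiniteType.isLocallyNoetherian π𝒴
  have : IsNoetherianRing Γ(X, U) := IsLocallyNoetherian.component_noetherian ⟨U, hU⟩
  have : IsNoetherianRing Γ(𝒴, V) := IsLocallyNoetherian.component_noetherian ⟨V, hV⟩
  have : Nonempty U := ⟨⟨x₀, hxU⟩⟩
  let θ : Γ(𝒴, V) →+* Γ(X, U) := ((f ≫ gY).appLE V U hUV).hom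
  have hideal : pullbackIdeal f j ⟨U, hU⟩ = (i.ker.ideal ⟨V, hV⟩).map θ :=
    pullbackIdeal_eq_map f j gY i gZ (isPullback_of_isModel hY hZ hij) hU hV hUV
  obtain ⟨ρ, hρ⟩ : ∃ ρ, hV.fromSpec ≫ π𝒴 = Spec.map ρ :=
    ⟨Spec.preimage (hV.fromSpec ≫ π𝒴), (Spec.map_preimage _).symm⟩
  have hρft : ρ.hom.FiniteType := by
    rw [← HasRingHomProperty.Spec_iff (P := @LocallyOfFiniteType), ← hρ]
    infer_instance
  have hpid : ∀ s : S, IsPrincipalIdealRing (Localization.AtPrime s.1.asIdeal) := fun s =>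
    isPrincipalIdealRing_localization s.1
  have hN := le_iSup_of_pullbackIdeal_ne_top f j ⟨U, hU⟩
  rw [hideal] at hN
  have hψ' : ∀ a, (ψ a : (l : Filter S).Germ k) = ((fun s => F s a : S → k)) := hψ
  have h₁ := eventually_forall_mem_range hval hρft (θ := θ) hψ'
  have h₂ := eventually_map_eq_bot_or_eq_maximalIdeal_pow hval hι
    (IsNoetherian.noetherian (i.ker.ideal ⟨V, hV⟩)) hψ'
    (hFφ.mono fun s ⟨φ, _, hφ⟩ => by rw [← hφ, map_zero]) hN
  -- A single bad `𝔪` satisfying all the almost-everywhere conditions suffices for the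
  -- contradiction.
  obtain ⟨s, hs₁, hs₂, φ, hφ, hφF⟩ := (h₁.and (h₂.and hFφ)).exists
  have hφ' : x s ≫ f ≫ gY = Spec.map (CommRingCat.ofHom (φ.hom.comp θ)) ≫ hV.fromSpec := by
    rw [hφ, Category.assoc, ← IsAffineOpen.SpecMap_appLE_fromSpec (f ≫ gY) hV hU hUV, ← Category.assoc,
      ← Spec.map_comp]
    rfl
  have hφρ : ρ ≫ CommRingCat.ofHom (φ.hom.comp θ) = CommRingCat.ofHom (algebraMap R k) := by
    apply Spec.map_injective
    rw [Spec.map_comp, ← hρ, ← Category.assoc, ← hφ', Category.assoc, Category.assoc, hY.w,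
      reassoc_of% hf]
    have h : x s ≫ πX = 𝟙 _ := hx s
    rw [reassoc_of% h]
  -- The coordinates of `f (x s)` in the chart `V` lie in `R_𝔪`, so the point extends to an
  -- `R_𝔪`-point inside `V`.
  obtain ⟨β, hβ⟩ := RingHom.exists_comp_eq_of_forall_mem_range (hι s) (φ.hom.comp θ)
    (hs₁ _ (fun b => hφF _) fun r => ⟨algebraMap R _ r, by
      rw [localizationToFractionField_algebraMap]
      exact congr($hφρ r).symm⟩)
  have hβρ : β.comp ρ.hom = algebraMap R _ := by
    ext r
    apply hι s
    rw [localizationToFractionField_algebraMap]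
    exact congr($hβ (ρ r)).trans congr($hφρ r)
  obtain ⟨y, hy, hy'⟩ := exists_mem_campanaPoints π𝒴 i s.1 hV β
    (by
      rw [hρ, ← Spec.map_comp]
      exact congr(Spec.map (CommRingCat.ofHom $hβρ)))
    (hs₂ β fun b => congr($hβ b).trans (hφF _))
  refine hxy s y hy ?_
  rw [RestrictsTo, hy', Category.assoc, hφ', ← Category.assoc, ← Spec.map_comp, ← hβ]
  rfl
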